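/- Write $\|\cdot\|$ and $\langle\cdot,\cdot\rangle$ for the Euclidean norm and inner product, and equip $\mathbb R^n\times\mathbb R^m$ with $\|(u,v)\|=\sqrt{\|u\|^2+\|v\|^2}$. For $A\subseteq\mathbb R^s$ and $x\in A$ let $T_A(x)$ be the (Bouligand) tangent cone, i.e. the set of all $w$ for which there are $t_k\searrow 0$ and $w_k\to w$ with $x+t_kw_k\in A$ for all $k$; let $\widehat N_A(x)=\{p : \langle p,w\rangle\le 0\ \text{for all } w\in T_A(x)\}$, and put $\widehat N_A(x)=\emptyset$ for $x\notin A$. For a direction $d$ let $N_A(x;d)$ be the set of all $p$ for which there are $t_k\searrow0$, $d_k\to d$, $p_k\to p$ with $p_k\in\widehat N_A(x+t_kd_k)$ for all $k$. The set $A$ is semismooth$^*$ at $\bar x\in A$ if $\langle p,u\rangle=0$ for all $u\in\mathbb R^s$ and all $p\in N_A(\bar x;u)$. A single-valued mapping $F:\mathbb R^n\to\mathbb R^m$ is semismooth$^*$ at $\bar x$ if its graph $\{(x,F(x)) : x\in\mathbb R^n\}$ is semismooth$^*$ at $(\bar x,F(\bar x))$. Let $\overline\nabla F(x)$ be the set of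 all limits $\lim_k \nabla F(u_k)$ where $u_k\to x$ and $F$ is differentiable at every $u_k$; its convex hull $\operatorname{co}\overline\nabla F(x)$ is the Clarke generalized Jacobian of $F$ at $x$. **Proposition.** Let $F:\mathbb R^n\to\mathbb R^m$ be Lipschitz continuous on a neighborhood of $\bar x\in\mathbb R^n$. Then the following are equivalent. (i) $F$ is semismooth$^*$ at $\bar x$. (ii) For every $\epsilon>0$ there is $\delta>0$ such that $$\|F(x)-F(\bar x)-C(x-\bar x)\|\le\epsilon\|x-\bar x\|$$ for all $x$ with $\|x-\bar x\|\le\delta$ and all $C\in\operatorname{co}\overline\nabla F(x)$. (iii) The mapping $x\mapsto\operatorname{co}\overline\nabla F(x)$ is a Newton map of $F$ at $\bar x$: there is a function $r:\mathbb R^n\to\mathbb R$ with $r(d)=o(\|d\|)$ as $d\to0$ such that, for all $d$ sufficiently close to $0$, $\|F(\bar x+d)-F(\bar x)-Cd\|\le r(d)$ for all $C\in\operatorname{co}\overline\nabla F(\bar x+d)$. -/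

import Mathlib

open Filter Topology
open scoped RealInnerProductSpace

namespace SemismoothStar

section Sets

variable {E : Type*} [NormedAddCommGroup E] [InnerProductSpace ℝ E]

/-- The tangent (contingent, Bouligand) cone `Limsup_{t ↘ 0} (A - x) / t`. -/
def tangentCone (A : Set E) (x : E) : Set E :=
  {w | ∃ (t : ℕ → ℝ) (w' : ℕ → E), (∀ k, 0 < t k) ∧ Tendsto t atTop (𝓝 0) ∧
    Tendsto w' atTop (𝓝 w) ∧ ∀ k, x + t k • w' k ∈ A}

/-- The regular (Fréchet) normal cone: the negative polar of the tangent cone at points of `A`,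
and empty (the usual convention) at points outside `A`. -/
def regularNormalCone (A : Set E) (x : E) : Set E :=
  {p | x ∈ A ∧ ∀ w ∈ tangentCone A x, ⟪p, w⟫ ≤ 0}

/-- The directional limiting normal cone to `A` at `x` in direction `d`: the outer limit of the
regular normal cones at `x + t d'` as `t ↘ 0` and `d' → d`. -/
def directionalNormalCone (A : Set E) (x d : E) : Set E :=
  {p | ∃ (t : ℕ → ℝ) (d' : ℕ → E) (p' : ℕ → E), (∀ k, 0 < t k) ∧ Tendsto t atTop (𝓝 0) ∧
    Tendsto d' atTop (𝓝 d) ∧ Tendsto p' atTop (𝓝 p) ∧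
    ∀ k, p' k ∈ regularNormalCone A (x + t k • d' k)}

/-- Semismoothness* of a set `A` at a point `x` of `A`. -/
def IsSemismoothStarSet (A : Set E) (x : E) : Prop :=
  x ∈ A ∧ ∀ u : E, ∀ p ∈ directionalNormalCone A x u, ⟪p, u⟫ = 0

end Sets

section Maps

variable {E F : Type*} [NormedAddCommGroup E] [InnerProductSpace ℝ E]
  [NormedAddCommGroup F] [InnerProductSpace ℝ F]

/-- The graph of a multifunction, in the product space with the Euclidean structure
`‖(u, v)‖ = √(‖u‖² + ‖v‖²)`. -/
def graph (G : E → Set F) : Set (WithLp 2 (E × F)) :=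
  {z | z.snd ∈ G z.fst}

/-- The directional limiting coderivative `D* G ((x, y); (u, v)) (q)`. -/
def directionalCoderivative (G : E → Set F) (x : E) (y : F) (u : E) (v : F) (q : F) : Set E :=
  {p | WithLp.toLp 2 (p, -q) ∈
    directionalNormalCone (graph G) (WithLp.toLp 2 (x, y)) (WithLp.toLp 2 (u, v))}

/-- Semismoothness* of a multifunction `G` at a point `(x, y)` of its graph. -/
def IsSemismoothStarMultifunction (G : E → Set F) (x : E) (y : F) : Prop :=
  IsSemismoothStarSet (graph G) (WithLp.toLp 2 (x, y))

/-- The description of semismoothness* of a multifunction by directional limiting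
coderivatives. -/
theorem isSemismoothStarMultifunction_iff (G : E → Set F) (x : E) (y : F) :
    IsSemismoothStarMultifunction G x y ↔
      y ∈ G x ∧ ∀ (u : E) (v q : F), ∀ p ∈ directionalCoderivative G x y u v q,
        ⟪p, u⟫ = ⟪q, v⟫ := by
  unfold IsSemismoothStarMultifunction IsSemismoothStarSet
  refine and_congr Iff.rfl ⟨fun h u v q p hp => ?_, fun h w z hz => ?_⟩
  · have := h _ _ hp
    simp only [WithLp.prod_inner_apply, inner_neg_left] at this
    linarith
  · have := h w.fst w.snd (-z.snd) z.fst (by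
      simp only [directionalCoderivative, neg_neg, Set.mem_ofPred_eq]
      exact hz)
    simp only [WithLp.prod_inner_apply]
    rw [inner_neg_left] at this
    change ⟪z.fst, w.fst⟫ + ⟪z.snd, w.snd⟫ = 0
    linarith

/-- Semismoothness* of a single-valued map `f` at `x`, that is, of the multifunction
`x ↦ {f x}` at `(x, f x)`. -/
def IsSemismoothStar (f : E → F) (x : E) : Prop :=
  IsSemismoothStarMultifunction (fun z => {f z}) x (f x)

/-- `f` is Lipschitz continuous on some neighborhood of `x`. -/
def LipschitzNear (f : E → F) (x : E) : Prop :=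
  ∃ L : NNReal, ∃ U ∈ 𝓝 x, LipschitzOnWith L f U

/-- The B-subdifferential: all limits of derivatives of `f` at points of differentiability
tending to `x` (matrices are represented by the linear maps they define). -/
def bSubdifferential (f : E → F) (x : E) : Set (E →L[ℝ] F) :=
  {A | ∃ u : ℕ → E, (∀ k, DifferentiableAt ℝ f (u k)) ∧ Tendsto u atTop (𝓝 x) ∧
    Tendsto (fun k => fderiv ℝ f (u k)) atTop (𝓝 A)}

/-- The Clarke generalized Jacobian. -/
def clarkeJacobian (f : E → F) (x : E) : Set (E →L[ℝ] F) :=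
  convexHull ℝ (bSubdifferential f x)

/-- `M` is a Newton map of `f` at `x`: `‖f (x + d) - f x - C d‖ = o(‖d‖)` as `d → 0`, uniformly
in the choice of `C ∈ M (x + d)`. -/
def IsNewtonMap (f : E → F) (M : E → Set (E →L[ℝ] F)) (x : E) : Prop :=
  ∃ r : E → ℝ, r =o[𝓝 0] (fun d : E => ‖d‖) ∧
    ∀ᶠ d in 𝓝 (0 : E), ∀ C ∈ M (x + d), ‖f (x + d) - f x - C d‖ ≤ r d

end Maps

end SemismoothStar

/-! All three conditions are compared with `HasUniformDerivativeEstimate`, the estimate of (ii)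
restricted to derivatives at points of differentiability. It passes to limits of derivatives and to
convex hulls, which gives (ii); taking a supremum over `C` turns (ii) into (iii).

Semismoothness* implies the estimate because every derivative `A` yields regular normals `(A* q,
-q)` to the graph. A sequence violating the estimate, rescaled, then has a limit normal not
orthogonal to its direction.

Conversely, a regular normal may sit at a point `z = x + t u` where `f` is not differentiable. The
estimate forces nearby derivatives to send `u` close to the quotient `v = (f z - f x) / t`. By
Rademacher and Fubini the increments of `f` at `z` along `±u` are then close to those of `±v`, so
the graph has tangents near `±(u, v)`, and testing the normal on them bounds its pairing with `(u,
v)`. -/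

namespace SemismoothStar

open MeasureTheory Set

/-! ### Mean value inequalities from almost everywhere derivatives -/

section MeanValue

variable {F : Type*} [NormedAddCommGroup F] [InnerProductSpace ℝ F]

/-- A mean value inequality for Lipschitz curves whose derivative is controlled almost
everywhere. -/
theorem norm_sub_sub_smul_le_of_ae_hasDerivAt {f : ℝ → F} {s ε : ℝ} {K : NNReal} (hs : 0 ≤ s)
    (hf : LipschitzOnWith K f (Icc 0 s)) (v : F)
    (h : ∀ᵐ t : ℝ, t ∈ Icc 0 s → ∃ f' : F, HasDerivAt f f' t ∧ ‖f' - v‖ ≤ ε) :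
    ‖f s - f 0 - s • v‖ ≤ ε * s := by
  -- Pairing with the error `e` itself reduces to a scalar function: `‖e‖ ^ 2` is the integral of
  -- `⟪e, f' - v⟫`, at most `‖e‖ * ε * s`.
  set e := f s - f 0 - s • v with he
  have hline : LipschitzWith ‖v‖₊ (fun t : ℝ => t • v) :=
    LipschitzWith.of_dist_le_mul fun a b => by
      rw [dist_eq_norm, ← sub_smul, norm_smul, mul_comm, dist_eq_norm]; rfl
  have hg : LipschitzOnWith (K + ‖v‖₊) (fun t => f t - t • v) (Icc 0 s) :=
    hf.sub (hline.lipschitzOnWith)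
  have hac : AbsolutelyContinuousOnInterval (fun t => ⟪e, f t - t • v⟫) 0 s := by
    have := (innerSL ℝ e).lipschitz.comp_lipschitzOnWith hg
    rw [← uIcc_of_le hs] at this
    exact this.absolutelyContinuousOnInterval
  have hint : ∫ t in (0 : ℝ)..s, deriv (fun t => ⟪e, f t - t • v⟫) t = ‖e‖ ^ 2 := by
    rw [hac.integral_deriv_eq_sub, ← inner_sub_right, ← real_inner_self_eq_norm_sq]
    congr 1
    rw [he]; simp only [zero_smul, sub_zero]; abel
  have hle : ∫ t in (0 : ℝ)..s, deriv (fun t => ⟪e, f t - t • v⟫) t ≤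
      ∫ _ in (0 : ℝ)..s, ‖e‖ * ε := by
    refine intervalIntegral.integral_mono_ae_restrict hs hac.intervalIntegrable_deriv
      intervalIntegrable_const ?_
    refine (ae_restrict_iff' measurableSet_Icc).2 ?_
    filter_upwards [h] with t ht hts
    obtain ⟨f', hf', hv⟩ := ht hts
    have hd : HasDerivAt (fun t => ⟪e, f t - t • v⟫) ⟪e, f' - v⟫ t := by
      have h1 : HasDerivAt (fun t => f t - t • v) (f' - v) t := by
        simpa using hf'.fun_sub ((hasDerivAt_id t).smul_const v)
      exact (innerSL ℝ e).hasFDerivAt.comp_hasDerivAt t h1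
    rw [hd.deriv]
    exact (real_inner_le_norm _ _).trans (by gcongr)
  rw [hint, intervalIntegral.integral_const, smul_eq_mul, sub_zero] at hle
  -- If `e = 0`, what remains is `0 ≤ ε * s`; the sign of `ε` is read off from `h` at one point when
  -- `0 < s`.
  rcases (norm_nonneg e).eq_or_lt with h0 | h0
  · rw [← h0]
    rcases hs.eq_or_lt with rfl | hs'
    · simp
    · have hex : ∃ f' : F, ‖f' - v‖ ≤ ε := by
        have hpos : (volume (Icc 0 s)) ≠ 0 := by simp [hs']
        obtain ⟨t, hts, ht⟩ := ((frequently_ae_mem_iff.2 hpos).and_eventually h).exists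
        obtain ⟨f', -, hv⟩ := ht hts
        exact ⟨f', hv⟩
      obtain ⟨f', hv⟩ := hex
      exact mul_nonneg ((norm_nonneg _).trans hv) hs
  · nlinarith

variable {E : Type*} [NormedAddCommGroup E] [InnerProductSpace ℝ E] [FiniteDimensional ℝ E]
  [FiniteDimensional ℝ F]

/-- A mean value inequality for Lipschitz maps whose derivative, wherever it exists, is
controlled in one direction. -/
theorem norm_sub_sub_smul_le_of_differentiableAt {f : E → F} {x w : E} {v : F} {R ε s : ℝ}
    {K : NNReal} (hf : LipschitzOnWith K f (Metric.ball x R))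
    (h : ∀ y ∈ Metric.ball x R, DifferentiableAt ℝ f y → ‖fderiv ℝ f y w - v‖ ≤ ε)
    (hs : 0 ≤ s) (hsR : s * ‖w‖ < R) :
    ‖f (x + s • w) - f x - s • v‖ ≤ ε * s := by
  let _ : MeasurableSpace E := borel E
  have : BorelSpace E := ⟨rfl⟩
  have hR : 0 < R := (by positivity : 0 ≤ s * ‖w‖).trans_lt hsR
  set S : Set E := {y | y ∈ Metric.ball x R → DifferentiableAt ℝ f y} with hS
  have hSm : MeasurableSet S := by
    have : S = (Metric.ball x R)ᶜ ∪ {y | DifferentiableAt ℝ f y} := by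
      ext y; simp only [hS, mem_ofPred_eq, mem_union, mem_compl_iff, imp_iff_not_or]
    rw [this]
    exact Metric.isOpen_ball.measurableSet.compl.union (measurableSet_of_differentiableAt ℝ f)
  have hSae : ∀ᵐ y ∂(Measure.addHaar : Measure E), y ∈ S := by
    filter_upwards [hf.ae_differentiableWithinAt_of_mem (μ := (Measure.addHaar : Measure E))]
      with y hy hyx
    exact (hy hyx).differentiableAt (Metric.isOpen_ball.mem_nhds hyx)
  -- The line through `x` may miss every point of differentiability. By Fubini almost every parallel
  -- line meets `S` at almost every parameter; such lines start from a dense set, and continuity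
  -- carries the bound back to `x`.
  have hlines := (ae_ae_add_linearMap_mem_iff (LinearMap.toSpanSingleton ℝ E w)
    (volume : Measure ℝ) Measure.addHaar hSm).2 hSae
  have hdense := Measure.dense_of_ae hlines
  set D : Set E := {y | ∀ᵐ t : ℝ, y + LinearMap.toSpanSingleton ℝ E w t ∈ S} with hD
  have hne : (𝓝[D] x).NeBot := mem_closure_iff_nhdsWithin_neBot.1 (hdense x)
  have hxs : x + s • w ∈ Metric.ball x R := by
    simpa [norm_smul, abs_of_nonneg hs] using hsR
  have hc : ∀ z ∈ Metric.ball x R, ContinuousAt f z := fun z hz =>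
    hf.continuousOn.continuousAt (Metric.isOpen_ball.mem_nhds hz)
  have hlim : Tendsto (fun y => ‖f (y + s • w) - f y - s • v‖) (𝓝[D] x)
      (𝓝 ‖f (x + s • w) - f x - s • v‖) := by
    have h1 : Tendsto (fun y => f (y + s • w)) (𝓝 x) (𝓝 (f (x + s • w))) :=
      (hc _ hxs).tendsto.comp ((continuous_add_const (s • w)).tendsto x)
    exact (((h1.sub (hc x (Metric.mem_ball_self hR)).tendsto).sub_const _).norm).mono_left
      nhdsWithin_le_nhds
  refine le_of_tendsto hlim ?_
  filter_upwards [self_mem_nhdsWithin, mem_nhdsWithin_of_mem_nhds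
    (Metric.ball_mem_nhds x (sub_pos.2 hsR))] with y hyD hyx
  have hin : ∀ t ∈ Icc 0 s, y + t • w ∈ Metric.ball x R := by
    intro t ht
    rw [mem_ball_iff_norm] at hyx ⊢
    calc ‖y + t • w - x‖ = ‖(y - x) + t • w‖ := by congr 1; abel
      _ ≤ ‖y - x‖ + t * ‖w‖ := by
        refine (norm_add_le _ _).trans_eq ?_
        rw [norm_smul, Real.norm_of_nonneg ht.1]
      _ ≤ ‖y - x‖ + s * ‖w‖ := by gcongr; exact ht.2
      _ < R := by linarith
  have hlip : LipschitzOnWith (K * ‖w‖₊) (fun t : ℝ => f (y + t • w)) (Icc 0 s) := by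
    refine LipschitzOnWith.comp (f := fun t : ℝ => y + t • w) hf ?_ hin
    refine (LipschitzWith.of_dist_le_mul fun a b => ?_).lipschitzOnWith
    rw [dist_add_left, dist_eq_norm, ← sub_smul, norm_smul, mul_comm, dist_eq_norm]; rfl
  have := norm_sub_sub_smul_le_of_ae_hasDerivAt hs hlip v (ε := ε) (by
    filter_upwards [hyD] with t ht hts
    have hd : DifferentiableAt ℝ f (y + t • w) := ht (hin t hts)
    refine ⟨fderiv ℝ f (y + t • w) w, ?_, h _ (hin t hts) hd⟩
    have hl : HasDerivAt (fun t : ℝ => y + t • w) w t := by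
      simpa using ((hasDerivAt_id t).smul_const w).const_add y
    exact hd.hasFDerivAt.comp_hasDerivAt t hl)
  simpa using this

end MeanValue

/-! ### Reduction of (ii) and (iii) to points of differentiability -/

section Characterization

theorem LipschitzNear.exists_ball {E F : Type*} [NormedAddCommGroup E]
    [NormedAddCommGroup F] {f : E → F} {x : E} (hf : LipschitzNear f x) :
    ∃ (L : NNReal) (R : ℝ), 0 < R ∧ LipschitzOnWith L f (Metric.ball x R) := by
  obtain ⟨L, U, hU, hL⟩ := hf
  obtain ⟨R, hR, hRU⟩ := Metric.mem_nhds_iff.1 hU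
  exact ⟨L, R, hR, hL.mono hRU⟩

variable {E F : Type*} [NormedAddCommGroup E] [InnerProductSpace ℝ E]
  [NormedAddCommGroup F] [InnerProductSpace ℝ F]

/-- The estimate of the Newton map property, restricted to points of differentiability and their
derivatives. -/
def HasUniformDerivativeEstimate (f : E → F) (x : E) : Prop :=
  ∀ ε : ℝ, 0 < ε → ∃ δ : ℝ, 0 < δ ∧ ∀ y ∈ Metric.closedBall x δ, DifferentiableAt ℝ f y →
    ‖f y - f x - fderiv ℝ f y (y - x)‖ ≤ ε * ‖y - x‖

theorem fderiv_mem_bSubdifferential {f : E → F} {y : E} (hy : DifferentiableAt ℝ f y) :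
    fderiv ℝ f y ∈ bSubdifferential f y :=
  ⟨fun _ => y, fun _ => hy, tendsto_const_nhds, tendsto_const_nhds⟩

theorem uniform_clarkeJacobian_estimate_iff {f : E → F} {x : E} (hf : LipschitzNear f x) :
    (∀ ε : ℝ, 0 < ε → ∃ δ : ℝ, 0 < δ ∧ ∀ y ∈ Metric.closedBall x δ,
      ∀ C ∈ clarkeJacobian f y, ‖f y - f x - C (y - x)‖ ≤ ε * ‖y - x‖) ↔
      HasUniformDerivativeEstimate f x := by
  refine ⟨fun h ε hε => ?_, fun h ε hε => ?_⟩
  · obtain ⟨δ, hδ, hδ'⟩ := h ε hε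
    exact ⟨δ, hδ, fun y hy hd =>
      hδ' y hy _ (subset_convexHull ℝ _ (fderiv_mem_bSubdifferential hd))⟩
  · obtain ⟨δ, hδ, hδ'⟩ := h ε hε
    obtain ⟨L, R, hR, hL⟩ := hf.exists_ball
    refine ⟨min δ R / 2, by positivity, fun y hy C hC => ?_⟩
    have hy' : y ∈ Metric.ball x (min δ R) := by
      have : 0 < min δ R := lt_min hδ hR
      rw [Metric.mem_closedBall] at hy
      rw [Metric.mem_ball]
      linarith
    have hyδ : Metric.closedBall x δ ∈ 𝓝 y :=
      mem_of_superset (Metric.isOpen_ball.mem_nhds hy')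
        ((Metric.ball_subset_ball (min_le_left _ _)).trans Metric.ball_subset_closedBall)
    have hfc : ContinuousAt f y :=
      hL.continuousOn.continuousAt (Metric.isOpen_ball.mem_nhds
        (Metric.ball_subset_ball (min_le_right _ _) hy'))
    have hconv : Convex ℝ {C : E →L[ℝ] F | ‖f y - f x - C (y - x)‖ ≤ ε * ‖y - x‖} := by
      have : {C : E →L[ℝ] F | ‖f y - f x - C (y - x)‖ ≤ ε * ‖y - x‖} =
          (ContinuousLinearMap.apply ℝ F (y - x)) ⁻¹'
            Metric.closedBall (f y - f x) (ε * ‖y - x‖) := by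
        ext C
        rw [mem_preimage, mem_closedBall_iff_norm', mem_ofPred_eq,
          ContinuousLinearMap.apply_apply]
      rw [this]
      exact (convex_closedBall _ _).is_linear_preimage
        (ContinuousLinearMap.apply ℝ F (y - x)).isBoundedLinearMap.toIsLinearMap
    refine convexHull_min ?_ hconv hC
    rintro A ⟨u, hud, hu, hA⟩
    have h1 : Tendsto (fun k => ‖f (u k) - f x - fderiv ℝ f (u k) (u k - x)‖) atTop
        (𝓝 ‖f y - f x - A (y - x)‖) :=
      (((hfc.tendsto.comp hu).sub_const _).sub ((isBoundedBilinearMap_apply.continuous.tendsto (A, y - x)).comp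
          (hA.prodMk_nhds (hu.sub_const x)))).norm
    refine le_of_tendsto_of_tendsto h1 (((hu.sub_const x).norm).const_mul ε) ?_
    filter_upwards [hu hyδ] with k hk using hδ' _ hk (hud k)

theorem uniform_clarkeJacobian_estimate_iff_isNewtonMap {f : E → F} {x : E}
    {M : E → Set (E →L[ℝ] F)} :
    (∀ ε : ℝ, 0 < ε → ∃ δ : ℝ, 0 < δ ∧ ∀ y ∈ Metric.closedBall x δ,
      ∀ C ∈ M y, ‖f y - f x - C (y - x)‖ ≤ ε * ‖y - x‖) ↔ IsNewtonMap f M x := by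
  constructor
  · intro h
    have h' : ∀ ε : ℝ, 0 < ε → ∀ᶠ d in 𝓝 (0 : E), ∀ C ∈ M (x + d),
        ‖f (x + d) - f x - C d‖ ≤ ε * ‖d‖ := by
      intro ε hε
      obtain ⟨δ, hδ, hδ'⟩ := h ε hε
      filter_upwards [Metric.closedBall_mem_nhds (0 : E) hδ] with d hd C hC
      simpa using hδ' (x + d) (by simpa using hd) C hC
    -- The real `sSup` is `0` on the empty set, so `r` is harmless where `M (x + d)` is empty; near
    -- `0` the set is bounded, by the case `ε = 1`.
    refine ⟨fun d => sSup ((fun C : E →L[ℝ] F => ‖f (x + d) - f x - C d‖) '' M (x + d)), ?_, ?_⟩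
    · refine Asymptotics.isLittleO_iff.2 fun ε hε => ?_
      filter_upwards [h' ε hε] with d hd
      rw [norm_norm, Real.norm_of_nonneg
        (Real.sSup_nonneg (by rintro _ ⟨C, -, rfl⟩; exact norm_nonneg _))]
      exact Real.sSup_le (by rintro _ ⟨C, hC, rfl⟩; exact hd C hC) (by positivity)
    · filter_upwards [h' 1 one_pos] with d hd C hC
      exact le_csSup ⟨1 * ‖d‖, by rintro _ ⟨C, hC, rfl⟩; exact hd C hC⟩ ⟨C, hC, rfl⟩
  · rintro ⟨r, hr, h⟩ ε hε
    obtain ⟨δ, hδ, hδ'⟩ := Metric.nhds_basis_closedBall.eventually_iff.1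
      (h.and (Asymptotics.isLittleO_iff.1 hr hε))
    refine ⟨δ, hδ, fun y hy C hC => ?_⟩
    obtain ⟨h1, h2⟩ := @hδ' (y - x) (by simpa [dist_eq_norm] using hy)
    rw [norm_norm] at h2
    have := h1 C (by simpa using hC)
    rw [add_sub_cancel] at this
    exact (this.trans (Real.le_norm_self _)).trans h2

/-! ### Tangents and regular normals to the graph -/

/-- At a point of differentiability, every tangent direction to the graph lies in the graph of
the derivative. -/
theorem snd_eq_of_mem_tangentCone_graph {f : E → F} {x : E} {A : E →L[ℝ] F}
    (hf : HasFDerivAt f A x) {w : WithLp 2 (E × F)}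
    (hw : w ∈ tangentCone (graph fun z => {f z}) (WithLp.toLp 2 (x, f x))) :
    w.snd = A w.fst := by
  obtain ⟨t, w', ht, ht0, hw', hmem⟩ := hw
  have hfst : Tendsto (fun k => (w' k).fst) atTop (𝓝 w.fst) :=
    ((WithLp.prod_continuous_ofLp 2 E F).fst.tendsto w).comp hw'
  have hsnd : Tendsto (fun k => (w' k).snd) atTop (𝓝 w.snd) :=
    ((WithLp.prod_continuous_ofLp 2 E F).snd.tendsto w).comp hw'
  have hd : Tendsto (fun k => t k • (w' k).fst) atTop (𝓝 0) := by
    simpa using ht0.smul hfst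
  have hlim := (hasFDerivWithinAt_univ.2 hf).lim (c := fun k => (t k)⁻¹) hd
    (Eventually.of_forall fun _ => mem_univ _) (v := w.fst) (by
      refine hfst.congr fun k => ?_
      rw [smul_smul, inv_mul_cancel₀ (ht k).ne', one_smul])
  refine tendsto_nhds_unique hsnd (hlim.congr fun k => ?_)
  have hk : f x + t k • (w' k).snd = f (x + t k • (w' k).fst) := hmem k
  rw [← hk, add_sub_cancel_left, smul_smul, inv_mul_cancel₀ (ht k).ne', one_smul]

theorem adjoint_mem_regularNormalCone_graph [CompleteSpace E] [CompleteSpace F] {f : E → F}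
    {x : E} {A : E →L[ℝ] F} (hf : HasFDerivAt f A x) (q : F) :
    WithLp.toLp 2 (A.adjoint q, -q) ∈
      regularNormalCone (graph fun z => {f z}) (WithLp.toLp 2 (x, f x)) := by
  refine ⟨rfl, fun w hw => ?_⟩
  have := snd_eq_of_mem_tangentCone_graph hf hw
  simp only [WithLp.prod_inner_apply, inner_neg_left]
  change ⟪A.adjoint q, w.fst⟫ + -⟪q, w.snd⟫ ≤ 0
  rw [this, ContinuousLinearMap.adjoint_inner_left]
  simp

/-- A regular normal to the graph is controlled along any direction in which the increments of the
function are controlled. -/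
theorem inner_le_of_mem_regularNormalCone_graph [FiniteDimensional ℝ F] {f : E → F} {x w p : E}
    {v q : F} {s₀ ε : ℝ} (hs₀ : 0 < s₀)
    (hf : ∀ s, 0 < s → s < s₀ → ‖f (x + s • w) - f x - s • v‖ ≤ ε * s)
    (hp : WithLp.toLp 2 (p, -q) ∈
      regularNormalCone (graph fun z => {f z}) (WithLp.toLp 2 (x, f x))) :
    ⟪p, w⟫ ≤ ⟪q, v⟫ + ‖q‖ * ε := by
  obtain ⟨s, -, hs, hs0⟩ := exists_seq_strictAnti_tendsto' hs₀
  set g : ℕ → F := fun k => (s k)⁻¹ • (f (x + s k • w) - f x) with hg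
  have hgb : ∀ k, g k ∈ Metric.closedBall v ε := by
    intro k
    have hk := (hs k).1
    have : g k - v = (s k)⁻¹ • (f (x + s k • w) - f x - s k • v) := by
      rw [hg, smul_sub _ _ (s k • v), smul_smul, inv_mul_cancel₀ hk.ne', one_smul]
    rw [mem_closedBall_iff_norm, this, norm_smul, norm_inv, Real.norm_of_nonneg hk.le,
      inv_mul_le_iff₀ hk, mul_comm]
    exact hf _ hk (hs k).2
  have : ProperSpace F := FiniteDimensional.proper_real F
  -- Directional derivatives need not exist, but a cluster point `v'` of the difference quotients
  -- still makes `(w, v')` tangent.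
  obtain ⟨v', hv', φ, hφ, hlim⟩ := (isCompact_closedBall v ε).tendsto_subseq hgb
  have hw : WithLp.toLp 2 (w, v') ∈
      tangentCone (graph fun z => {f z}) (WithLp.toLp 2 (x, f x)) := by
    refine ⟨fun k => s (φ k), fun k => WithLp.toLp 2 (w, g (φ k)), fun k => (hs _).1,
      hs0.comp hφ.tendsto_atTop, ?_, fun k => ?_⟩
    · exact ((WithLp.prod_continuous_toLp 2 E F).tendsto (w, v')).comp
        (tendsto_const_nhds.prodMk_nhds hlim)
    · change f x + s (φ k) • g (φ k) = f (x + s (φ k) • w)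
      rw [hg, smul_smul, mul_inv_cancel₀ (hs _).1.ne', one_smul]
      abel
  have hle := hp.2 _ hw
  simp only [WithLp.prod_inner_apply, inner_neg_left] at hle
  change ⟪p, w⟫ + -⟪q, v'⟫ ≤ 0 at hle
  have h1 : ⟪q, v' - v⟫ ≤ ‖q‖ * ε :=
    (real_inner_le_norm _ _).trans (by gcongr; exact mem_closedBall_iff_norm.1 hv')
  rw [inner_sub_right] at h1
  linarith

/-! ### The derivative estimate implies semismoothness* -/

variable [FiniteDimensional ℝ E] [FiniteDimensional ℝ F]

theorem abs_inner_sub_inner_le_of_mem_regularNormalCone_graph {f : E → F} {x u p : E} {v q : F}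
    {t δ ε : ℝ} {L : NNReal} (hL : LipschitzOnWith L f (Metric.ball x δ)) (hε : 0 < ε)
    (h : ∀ y ∈ Metric.ball x δ, DifferentiableAt ℝ f y →
      ‖f y - f x - fderiv ℝ f y (y - x)‖ ≤ ε * ‖y - x‖)
    (ht : 0 < t) (hx : x + t • u ∈ Metric.ball x δ) (hv : f (x + t • u) = f x + t • v)
    (hp : WithLp.toLp 2 (p, -q) ∈ regularNormalCone (graph fun z => {f z})
      (WithLp.toLp 2 (x + t • u, f (x + t • u)))) :
    |⟪p, u⟫ - ⟪q, v⟫| ≤ ‖q‖ * (ε * (‖u‖ + 1)) := by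
  set z := x + t • u with hz
  have hzx : ‖z - x‖ = t * ‖u‖ := by
    rw [hz, add_sub_cancel_left, norm_smul, Real.norm_of_nonneg ht.le]
  obtain ⟨ρ, hρ, hρδ⟩ := Metric.isOpen_iff.1 Metric.isOpen_ball z hx
  -- Moving from `z` to `y` costs `(ε + 2 * L) * ‖y - z‖`: `ε` from the estimate and `L` each from
  -- the derivative and from `f`. This radius keeps the cost below `t * ε`, the `+ 1` in the bound.
  set R := min ρ (t * ε / (ε + 2 * L)) with hR
  have hR0 : 0 < R := by positivity
  have hRδ : Metric.ball z R ⊆ Metric.ball x δ :=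
    (Metric.ball_subset_ball (min_le_left _ _)).trans hρδ
  have key : ∀ y ∈ Metric.ball z R, DifferentiableAt ℝ f y →
      ‖fderiv ℝ f y u - v‖ ≤ ε * (‖u‖ + 1) := by
    intro y hy hd
    have hyx := hRδ hy
    have hA : ‖fderiv ℝ f y‖ ≤ L :=
      norm_fderiv_le_of_lipschitzOn ℝ (Metric.isOpen_ball.mem_nhds hyx) hL
    have hyz : ‖y - z‖ * (ε + 2 * L) ≤ t * ε := by
      rw [← le_div_iff₀ (by positivity)]
      exact (mem_ball_iff_norm.1 hy).le.trans (min_le_right _ _)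
    have hdec : t • (fderiv ℝ f y u - v) =
        -(f y - f x - fderiv ℝ f y (y - x)) - fderiv ℝ f y (y - z) + (f y - f z) := by
      rw [hv, hz, map_sub, map_sub, map_add, map_smul, smul_sub]
      abel
    have h1 := h y hyx hd
    have h2 : ‖fderiv ℝ f y (y - z)‖ ≤ L * ‖y - z‖ :=
      (ContinuousLinearMap.le_opNorm _ _).trans (by gcongr)
    have h3 : ‖f y - f z‖ ≤ L * ‖y - z‖ := hL.norm_sub_le hyx hx
    have h4 : ‖y - x‖ ≤ ‖y - z‖ + t * ‖u‖ := by
      rw [← hzx]; exact norm_sub_le_norm_sub_add_norm_sub _ _ _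
    have h5 : t * ‖fderiv ℝ f y u - v‖ ≤
        ‖f y - f x - fderiv ℝ f y (y - x)‖ + ‖fderiv ℝ f y (y - z)‖ + ‖f y - f z‖ := by
      have hnt : t * ‖fderiv ℝ f y u - v‖ = ‖t • (fderiv ℝ f y u - v)‖ := by
        rw [norm_smul, Real.norm_of_nonneg ht.le]
      rw [hnt, hdec]
      refine (norm_add_le _ _).trans (add_le_add_left ((norm_sub_le _ _).trans ?_) _)
      rw [norm_neg]
    have h6 : ε * ‖y - x‖ ≤ ε * (‖y - z‖ + t * ‖u‖) := by gcongr
    refine le_of_mul_le_mul_left ?_ ht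
    nlinarith
  have hLR := hL.mono hRδ
  have hs₀ : 0 < R / (‖u‖ + 1) := by positivity
  have hsR : ∀ s, 0 < s → s < R / (‖u‖ + 1) → s * ‖u‖ < R := by
    intro s hs hs'
    rw [lt_div_iff₀ (by positivity)] at hs'
    nlinarith
  have hpos := inner_le_of_mem_regularNormalCone_graph (w := u) (v := v) hs₀
    (fun s hs hs' => norm_sub_sub_smul_le_of_differentiableAt hLR key hs.le (hsR s hs hs')) hp
  -- The direction `-u` supplies the opposite inequality.
  have hneg := inner_le_of_mem_regularNormalCone_graph (w := -u) (v := -v) hs₀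
    (fun s hs hs' => norm_sub_sub_smul_le_of_differentiableAt hLR (ε := ε * (‖u‖ + 1))
      (fun y hy hd => by
        rw [map_neg, ← neg_sub', norm_neg]; exact key y hy hd) hs.le
      (by rw [norm_neg]; exact hsR s hs hs')) hp
  rw [inner_neg_right, inner_neg_right] at hneg
  rw [abs_le]
  constructor <;> linarith

theorem HasUniformDerivativeEstimate.isSemismoothStar {f : E → F} {x : E}
    (hf : LipschitzNear f x) (h : HasUniformDerivativeEstimate f x) : IsSemismoothStar f x := by
  refine (isSemismoothStarMultifunction_iff _ _ _).2 ⟨rfl, ?_⟩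
  rintro u v q p ⟨t, d, p', ht, ht0, hd, hp', hmem⟩
  have hfst : Continuous (WithLp.fst : WithLp 2 (E × F) → E) :=
    continuous_fst.comp (WithLp.prod_continuous_ofLp 2 E F)
  have hsnd : Continuous (WithLp.snd : WithLp 2 (E × F) → F) :=
    continuous_snd.comp (WithLp.prod_continuous_ofLp 2 E F)
  have hu : Tendsto (fun k => (d k).fst) atTop (𝓝 u) := (hfst.tendsto (WithLp.toLp 2 (u, v))).comp hd
  have hv : Tendsto (fun k => (d k).snd) atTop (𝓝 v) := (hsnd.tendsto (WithLp.toLp 2 (u, v))).comp hd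
  have hp : Tendsto (fun k => (p' k).fst) atTop (𝓝 p) := (hfst.tendsto (WithLp.toLp 2 (p, -q))).comp hp'
  have hq : Tendsto (fun k => -(p' k).snd) atTop (𝓝 q) := by
    simpa using ((hsnd.tendsto (WithLp.toLp 2 (p, -q))).comp hp').neg
  obtain ⟨L, R, hR, hL⟩ := hf.exists_ball
  have hbound : ∀ ε : ℝ, 0 < ε → |⟪p, u⟫ - ⟪q, v⟫| ≤ ε * (‖q‖ * (‖u‖ + 1)) := by
    intro ε hε
    obtain ⟨δ, hδ, hδ'⟩ := h ε hε
    have hlim := ((hp.inner (𝕜 := ℝ) hu).sub (hq.inner (𝕜 := ℝ) hv)).abs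
    have hlim' := hq.norm.mul (((hu.norm).add_const 1).const_mul ε)
    refine (le_of_tendsto_of_tendsto hlim hlim' ?_).trans_eq (by ring)
    have hx : Tendsto (fun k => x + t k • (d k).fst) atTop (𝓝 x) := by
      simpa using (ht0.smul hu).const_add x
    filter_upwards [hx (Metric.ball_mem_nhds x (lt_min hδ hR))] with k hk
    have hgr : f x + t k • (d k).snd = f (x + t k • (d k).fst) := (hmem k).1
    refine abs_inner_sub_inner_le_of_mem_regularNormalCone_graph
      (hL.mono (Metric.ball_subset_ball (min_le_right δ R))) hε
      (fun y hy => hδ' y (Metric.ball_subset_closedBall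
        (Metric.ball_subset_ball (min_le_left _ _) hy))) (ht k) hk hgr.symm ?_
    rw [← hgr, neg_neg]
    exact hmem k
  have hzero : |⟪p, u⟫ - ⟪q, v⟫| ≤ 0 := by
    have : Tendsto (fun ε : ℝ => ε * (‖q‖ * (‖u‖ + 1))) (𝓝[>] 0) (𝓝 0) := by
      have : Tendsto (fun ε : ℝ => ε * (‖q‖ * (‖u‖ + 1))) (𝓝 0) (𝓝 (0 * (‖q‖ * (‖u‖ + 1)))) :=
        (continuous_mul_const _).tendsto 0
      rw [zero_mul] at this
      exact this.mono_left nhdsWithin_le_nhds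
    exact ge_of_tendsto this (by filter_upwards [self_mem_nhdsWithin] with ε hε using hbound ε hε)
  exact sub_eq_zero.1 (abs_nonpos_iff.1 hzero)

/-! ### Semismoothness* implies the derivative estimate -/

theorem IsSemismoothStar.hasUniformDerivativeEstimate {f : E → F} {x : E}
    (hf : LipschitzNear f x) (h : IsSemismoothStar f x) : HasUniformDerivativeEstimate f x := by
  have h' := ((isSemismoothStarMultifunction_iff _ _ _).1 h).2
  obtain ⟨L, R, hR, hL⟩ := hf.exists_ball
  by_contra hcon
  simp only [HasUniformDerivativeEstimate, not_forall, not_exists, not_and, not_le] at hcon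
  obtain ⟨ε, hε, hcon⟩ := hcon
  obtain ⟨s, -, hs, hs0⟩ := exists_seq_strictAnti_tendsto' hR
  choose y hy hyd hlt using fun k => hcon (s k) (hs k).1
  have hyx : Tendsto y atTop (𝓝 x) :=
    tendsto_iff_dist_tendsto_zero.2
      (squeeze_zero (fun _ => dist_nonneg) (fun k => Metric.mem_closedBall.1 (hy k)) hs0)
  have hyR : ∀ k, y k ∈ Metric.ball x R := fun k =>
    Metric.mem_ball.2 ((Metric.mem_closedBall.1 (hy k)).trans_lt (hs k).2)
  have hne : ∀ k, 0 < ‖y k - x‖ := by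
    intro k
    rw [norm_pos_iff]
    intro h0
    have := hlt k
    rw [sub_eq_zero.1 h0] at this
    simp at this
  set t : ℕ → ℝ := fun k => ‖y k - x‖ with ht
  have ht0 : Tendsto t atTop (𝓝 0) := by
    simpa using (hyx.sub_const x).norm
  set A : ℕ → E →L[ℝ] F := fun k => fderiv ℝ f (y k) with hAdef
  set u : ℕ → E := fun k => (t k)⁻¹ • (y k - x) with hu
  set v : ℕ → F := fun k => (t k)⁻¹ • (f (y k) - f x) with hv
  -- The unit vector along the residual makes `⟪q, v - A u⟫` equal to the norm of the residual, so
  -- the gap `ε` survives in the limit.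
  set q : ℕ → F := fun k => ‖v k - A k (u k)‖⁻¹ • (v k - A k (u k)) with hq
  have hgap : ∀ k, ε < ‖v k - A k (u k)‖ := by
    intro k
    have : v k - A k (u k) = (t k)⁻¹ • (f (y k) - f x - A k (y k - x)) := by
      rw [hu, hv, map_smul, ← smul_sub]
    rw [this, norm_smul, norm_inv, Real.norm_of_nonneg (hne k).le, lt_inv_mul_iff₀ (hne k),
      mul_comm]
    exact hlt k
  have hA : ∀ k, ‖A k‖ ≤ L := fun k =>
    norm_fderiv_le_of_lipschitzOn ℝ (Metric.isOpen_ball.mem_nhds (hyR k)) hL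
  have hub : ∀ k, ‖u k‖ ≤ 1 := fun k => by
    rw [hu, norm_smul, norm_inv, Real.norm_of_nonneg (hne k).le, inv_mul_cancel₀ (hne k).ne']
  have hvb : ∀ k, ‖v k‖ ≤ L := fun k => by
    rw [hv, norm_smul, norm_inv, Real.norm_of_nonneg (hne k).le, inv_mul_le_iff₀ (hne k), mul_comm]
    exact hL.norm_sub_le (hyR k) (Metric.mem_ball_self hR)
  have hqn : ∀ k, ‖q k‖ = 1 := fun k => by
    rw [hq, norm_smul, norm_inv, norm_norm, inv_mul_cancel₀ (hε.trans (hgap k)).ne']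
  have hpb : ∀ k, ‖(A k).adjoint (q k)‖ ≤ L := fun k => by
    have := (A k).adjoint.le_opNorm (q k)
    rw [hqn, mul_one, LinearIsometryEquiv.norm_map] at this
    exact this.trans (hA k)
  have hinner : ∀ k, ε < ⟪q k, v k⟫ - ⟪(A k).adjoint (q k), u k⟫ := by
    intro k
    rw [ContinuousLinearMap.adjoint_inner_left, ← inner_sub_right, hq, real_inner_smul_left,
      real_inner_self_eq_norm_sq, sq, ← mul_assoc,
      inv_mul_cancel₀ (hε.trans (hgap k)).ne', one_mul]
    exact hgap k
  have : ProperSpace E := FiniteDimensional.proper_real E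
  have : ProperSpace F := FiniteDimensional.proper_real F
  -- The Lipschitz constant bounds both the quotients `v k` and the adjoint images, so all four
  -- sequences converge along one subsequence.
  obtain ⟨⟨⟨u₀, v₀⟩, ⟨p₀, q₀⟩⟩, -, φ, hφ, hlim⟩ :=
    ((((isCompact_closedBall (0 : E) 1).prod (isCompact_closedBall (0 : F) L)).prod
      ((isCompact_closedBall (0 : E) L).prod (isCompact_closedBall (0 : F) 1))).tendsto_subseq
      (x := fun k => ((u k, v k), ((A k).adjoint (q k), q k)))
      fun k => ⟨⟨by simpa using hub k, by simpa using hvb k⟩,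
        ⟨by simpa using hpb k, by simpa using (hqn k).le⟩⟩)
  have hlu := hlim.fst_nhds.fst_nhds
  have hlv := hlim.fst_nhds.snd_nhds
  have hlp := hlim.snd_nhds.fst_nhds
  have hlq := hlim.snd_nhds.snd_nhds
  have hco : p₀ ∈ directionalCoderivative (fun z => {f z}) x (f x) u₀ v₀ q₀ := by
    refine ⟨fun k => t (φ k), fun k => WithLp.toLp 2 (u (φ k), v (φ k)),
      fun k => WithLp.toLp 2 ((A (φ k)).adjoint (q (φ k)), -q (φ k)), fun k => hne _,
      ht0.comp hφ.tendsto_atTop, ?_, ?_, fun k => ?_⟩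
    · exact ((WithLp.prod_continuous_toLp 2 E F).tendsto (u₀, v₀)).comp (hlu.prodMk_nhds hlv)
    · exact ((WithLp.prod_continuous_toLp 2 E F).tendsto (p₀, -q₀)).comp
        (hlp.prodMk_nhds hlq.neg)
    · have h1 : x + t (φ k) • u (φ k) = y (φ k) := by
        rw [hu, smul_smul, mul_inv_cancel₀ (hne _).ne', one_smul, add_sub_cancel]
      have h2 : f x + t (φ k) • v (φ k) = f (y (φ k)) := by
        rw [hv, smul_smul, mul_inv_cancel₀ (hne _).ne', one_smul, add_sub_cancel]
      have h3 : WithLp.toLp 2 (x, f x) + t (φ k) • WithLp.toLp 2 (u (φ k), v (φ k)) =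
          WithLp.toLp 2 (y (φ k), f (y (φ k))) := by
        rw [← h1, h1, ← h2, ← h1]; rfl
      rw [h3]
      exact adjoint_mem_regularNormalCone_graph (hyd _).hasFDerivAt _
  have heq := h' u₀ v₀ q₀ p₀ hco
  have hge : ε ≤ ⟪q₀, v₀⟫ - ⟪p₀, u₀⟫ :=
    ge_of_tendsto ((hlq.inner hlv).sub (hlp.inner hlu))
      (Eventually.of_forall fun k => (hinner (φ k)).le)
  linarith

theorem isSemismoothStar_iff_hasUniformDerivativeEstimate {f : E → F} {x : E}
    (hf : LipschitzNear f x) : IsSemismoothStar f x ↔ HasUniformDerivativeEstimate f x :=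
  ⟨fun h => h.hasUniformDerivativeEstimate hf, fun h => h.isSemismoothStar hf⟩

end Characterization

end SemismoothStar

theorem mainTheorem8 (n m : ℕ)
    (F : EuclideanSpace ℝ (Fin n) → EuclideanSpace ℝ (Fin m)) (xbar : EuclideanSpace ℝ (Fin n))
    (hF : SemismoothStar.LipschitzNear F xbar) :
    (SemismoothStar.IsSemismoothStar F xbar ↔
      ∀ ε : ℝ, 0 < ε → ∃ δ : ℝ, 0 < δ ∧ ∀ x ∈ Metric.closedBall xbar δ,
        ∀ C ∈ SemismoothStar.clarkeJacobian F x,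
          ‖F x - F xbar - C (x - xbar)‖ ≤ ε * ‖x - xbar‖) ∧
    (SemismoothStar.IsSemismoothStar F xbar ↔
      SemismoothStar.IsNewtonMap F (SemismoothStar.clarkeJacobian F) xbar) := by
  have h := (SemismoothStar.isSemismoothStar_iff_hasUniformDerivativeEstimate hF).trans
    (SemismoothStar.uniform_clarkeJacobian_estimate_iff hF).symm
  exact ⟨h, h.trans SemismoothStar.uniform_clarkeJacobian_estimate_iff_isNewtonMap⟩
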